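/- Let $d\in\{2,3\}$, let $\Omega\subset\mathbb R^d$ be a bounded Lipschitz domain and let $\mathbb K$ be $\mathbb R$ or $\mathbb C$. Write $\|\cdot\|_0$ for the norm of $L^2(\Omega,\mathbb K)$, $\|v\|_1=(\|v\|_0^2+\|\nabla v\|_0^2)^{1/2}$ for the norm of $H^1(\Omega,\mathbb K)$, and $V=H^1(\Omega,\mathbb K)\times H^1(\Omega,\mathbb K)$. Let $D_1,D_2,\Sigma_{a1},\Sigma_{a2},\Sigma_{1\to2}$ be strictly positive constants, and let $\nu_1\Sigma_{f1},\nu_2\Sigma_{f2},\alpha_1,\alpha_2$ be nonnegative constants. For $(\phi_1,\phi_2),(v_1,v_2)\in V$ put $$\begin{aligned}a((\phi_1,\phi_2),(v_1,v_2))={}&\int_\Omega D_1\nabla\phi_1\cdot\nabla\overline{v_1}+(\Sigma_{a1}+\Sigma_{1\to2})\phi_1\overline{v_1}\,dx\\&+\int_\Omega D_2\nabla\phi_2\cdot\nabla\overline{v_2}+\Sigma_{a2}\phi_2\overline{v_2}-\Sigma_{1\to2}\phi_1\overline{v_2}\,dx+\int_{\partial\Omega}\alpha_1\phi_1\overline{v_1}+\alpha_2\phi_2\overline{v_2}\,dS,\end{aligned}$$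 where boundary values are taken in the sense of traces, and for $(f_1,f_2),(v_1,v_2)\in L^2(\Omega,\mathbb K)^2$ put $$b((f_1,f_2),(v_1,v_2))=\int_\Omega(\nu_1\Sigma_{f1}f_1+\nu_2\Sigma_{f2}f_2)\overline{v_1}\,dx.$$ Let $\widetilde\alpha_1=\min\{D_1,\Sigma_{a1}+\Sigma_{1\to2}\}$ and $\widetilde\alpha_2=\min\{D_2,\Sigma_{a2}\}$, and let $f_1,f_2\in L^2(\Omega,\mathbb K)$. (i) Source problem. There is a unique $(\widetilde\phi_1,\widetilde\phi_2)\in V$ such that $a((\widetilde\phi_1,\widetilde\phi_2),(v_1,v_2))=b((f_1,f_2),(v_1,v_2))$ for all $(v_1,v_2)\in V$. With $F=\nu_1\Sigma_{f1}\|f_1\|_0+\nu_2\Sigma_{f2}\|f_2\|_0$ it satisfies $$\widetilde\alpha_1\|\widetilde\phi_1\|_1\le F,\qquad \widetilde\alpha_2\|\widetilde\phi_2\|_1\le\Sigma_{1\to2}\|\widetilde\phi_1\|_0\le\frac{\Sigma_{1\to2}}{\widetilde\alpha_1}F,\qquad \widetilde\alpha_1\|\widetilde\phi_1\|_1+\widetilde\alpha_2\|\widetilde\phi_2\|_1\le\Big(1+\frac{\Sigma_{1\to2}}{\widetilde\alpha_1}\Big)F.$$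 (ii) Adjoint problem. There is a unique $(\phi_1^*,\phi_2^*)\in V$ such that $a((v_1,v_2),(\phi_1^*,\phi_2^*))=b((v_1,v_2),(f_1,f_2))$ for all $(v_1,v_2)\in V$. It satisfies $$\widetilde\alpha_2\|\phi_2^*\|_1\le\nu_2\Sigma_{f2}\|f_1\|_0,\qquad \widetilde\alpha_1\|\phi_1^*\|_1\le\nu_1\Sigma_{f1}\|f_1\|_0+\Sigma_{1\to2}\|\phi_2^*\|_0\le\Big(\nu_1\Sigma_{f1}+\frac{\Sigma_{1\to2}\,\nu_2\Sigma_{f2}}{\widetilde\alpha_2}\Big)\|f_1\|_0,$$ $$\widetilde\alpha_1\|\phi_1^*\|_1+\widetilde\alpha_2\|\phi_2^*\|_1\le\Big(\nu_1\Sigma_{f1}+\Big(1+\frac{\Sigma_{1\to2}}{\widetilde\alpha_2}\Big)\nu_2\Sigma_{f2}\Big)\|f_1\|_0.$$ -/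

import Mathlib

open MeasureTheory Filter Topology
open scoped ContDiff

namespace TwoGroup

/-- A bounded Lipschitz domain in `ℝᵈ`: a bounded, connected (in particular nonempty) open set
that lies, near each of its boundary points and in a suitable orthonormal frame, on one side of
the graph of a Lipschitz function. Here `e` is the last vector of the frame,
`⟪e, y⟫` the last coordinate of `y`, and `y - ⟪e, y⟫ e` stands for the remaining coordinates. -/
structure IsBoundedLipschitzDomain {d : ℕ} (Ω : Set (EuclideanSpace ℝ (Fin d))) : Prop where
  isOpen : IsOpen Ω
  isConnected : IsConnected Ω
  isBounded : Bornology.IsBounded Ω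
  lipschitz_boundary : ∀ x ∈ frontier Ω, ∃ r : ℝ, 0 < r ∧
    ∃ e : EuclideanSpace ℝ (Fin d), ‖e‖ = 1 ∧
    ∃ (K : NNReal) (γ : EuclideanSpace ℝ (Fin d) → ℝ), LipschitzWith K γ ∧
      ∀ y ∈ Metric.ball x r, (y ∈ Ω ↔ γ (y - inner ℝ e y • e) < inner ℝ e y)

/-- `L²(Ω, 𝕜)`, with respect to Lebesgue measure. -/
noncomputable abbrev L2 {d : ℕ} (Ω : Set (EuclideanSpace ℝ (Fin d))) (𝕜 : Type*) [RCLike 𝕜] :=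
  Lp 𝕜 2 ((volume : Measure (EuclideanSpace ℝ (Fin d))).restrict Ω)

/-- The surface measure `dS` on `∂Ω`: the `(d-1)`-dimensional Hausdorff measure, normalised so
that it agrees with Lebesgue measure on hyperplanes. -/
noncomputable def surfaceMeasure {d : ℕ} (Ω : Set (EuclideanSpace ℝ (Fin d))) :
    Measure (EuclideanSpace ℝ (Fin d)) :=
  (Measure.euclideanHausdorffMeasure (d - 1)).restrict (frontier Ω)

/-- `L²(∂Ω, 𝕜)`, with respect to surface measure. -/
noncomputable abbrev BoundaryL2 {d : ℕ} (Ω : Set (EuclideanSpace ℝ (Fin d))) (𝕜 : Type*) [RCLike 𝕜] :=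
  Lp 𝕜 2 (surfaceMeasure Ω)

/-- The classical partial derivative `∂ᵢ ψ (x)`. -/
noncomputable def partialDeriv {d : ℕ} {F : Type*} [NormedAddCommGroup F] [NormedSpace ℝ F]
    (i : Fin d) (ψ : EuclideanSpace ℝ (Fin d) → F) (x : EuclideanSpace ℝ (Fin d)) : F :=
  fderiv ℝ ψ x (EuclideanSpace.single i (1 : ℝ))

/-- `w` is the weak `i`-th partial derivative of `u` on `Ω`:
`∫_Ω u ∂ᵢψ = - ∫_Ω w ψ` for all `ψ ∈ C_c^∞(Ω)`. -/
def IsWeakPartial {d : ℕ} {𝕜 : Type*} [RCLike 𝕜] (Ω : Set (EuclideanSpace ℝ (Fin d)))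
    (i : Fin d) (u w : EuclideanSpace ℝ (Fin d) → 𝕜) : Prop :=
  ∀ ψ : EuclideanSpace ℝ (Fin d) → ℝ, ContDiff ℝ ∞ ψ → HasCompactSupport ψ → tsupport ψ ⊆ Ω →
    ∫ x in Ω, partialDeriv i ψ x • u x = - ∫ x in Ω, ψ x • w x

/-- The Sobolev space `H¹(Ω, 𝕜)`: square-integrable functions (modulo a.e. equality) that have a
square-integrable weak gradient. The gradient is carried along; it is determined by the function
whenever `Ω` is open. -/
@[ext]
structure H1 {d : ℕ} (Ω : Set (EuclideanSpace ℝ (Fin d))) (𝕜 : Type*) [RCLike 𝕜] where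
  val : L2 Ω 𝕜
  grad : Fin d → L2 Ω 𝕜
  isWeakPartial : ∀ i, IsWeakPartial Ω i val (grad i)

/-- `‖u‖₁ = (‖u‖₀² + ‖∇u‖₀²)^{1/2}`. -/
noncomputable def H1.norm {d : ℕ} {Ω : Set (EuclideanSpace ℝ (Fin d))} {𝕜 : Type*} [RCLike 𝕜]
    (u : H1 Ω 𝕜) : ℝ :=
  Real.sqrt (‖u.val‖ ^ 2 + ∑ i, ‖u.grad i‖ ^ 2)

/-- `g ∈ L²(∂Ω)` is the trace of `u ∈ H¹(Ω)`: some sequence of functions that are smooth up to the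
boundary converges to `u` in `H¹(Ω)` while its boundary values converge to `g` in `L²(∂Ω)`.
On a bounded Lipschitz domain every `u ∈ H¹(Ω)` has exactly one trace. -/
def IsTrace {d : ℕ} {Ω : Set (EuclideanSpace ℝ (Fin d))} {𝕜 : Type*} [RCLike 𝕜]
    (u : H1 Ω 𝕜) (g : BoundaryL2 Ω 𝕜) : Prop :=
  ∃ ψ : ℕ → EuclideanSpace ℝ (Fin d) → 𝕜, (∀ n, ContDiff ℝ ∞ (ψ n)) ∧
    Tendsto (fun n => eLpNorm (fun x => ψ n x - u.val x) 2 (volume.restrict Ω)) atTop (𝓝 0) ∧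
    (∀ i, Tendsto (fun n => eLpNorm (fun x => partialDeriv i (ψ n) x - u.grad i x) 2
      (volume.restrict Ω)) atTop (𝓝 0)) ∧
    Tendsto (fun n => eLpNorm (fun x => ψ n x - g x) 2 (surfaceMeasure Ω)) atTop (𝓝 0)

/-- The constant coefficients of the two-group model: diffusion coefficients `D₁, D₂`, absorption
cross sections `Sa₁, Sa₂` (for `Σ_{a1}, Σ_{a2}`), the scattering cross section `S₁₂` (for
`Σ_{1→2}`), the fission coefficients `nuSf₁, nuSf₂` (for `ν₁Σ_{f1}, ν₂Σ_{f2}`) and the boundary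
coefficients `α₁, α₂`. -/
structure Coefficients where
  D₁ : ℝ
  D₂ : ℝ
  Sa₁ : ℝ
  Sa₂ : ℝ
  S₁₂ : ℝ
  nuSf₁ : ℝ
  nuSf₂ : ℝ
  α₁ : ℝ
  α₂ : ℝ

/-- The sesquilinear form `a((φ₁, φ₂), (v₁, v₂))`; `g₁, g₂, h₁, h₂` are the traces of
`φ₁, φ₂, v₁, v₂`. -/
noncomputable def formA {d : ℕ} {Ω : Set (EuclideanSpace ℝ (Fin d))} {𝕜 : Type*} [RCLike 𝕜]
    (c : Coefficients) (φ₁ φ₂ : H1 Ω 𝕜) (g₁ g₂ : BoundaryL2 Ω 𝕜)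
    (v₁ v₂ : H1 Ω 𝕜) (h₁ h₂ : BoundaryL2 Ω 𝕜) : 𝕜 :=
  (∫ x in Ω, ((c.D₁ : 𝕜) * ∑ i, φ₁.grad i x * starRingEnd 𝕜 (v₁.grad i x)
      + ((c.Sa₁ + c.S₁₂ : ℝ) : 𝕜) * φ₁.val x * starRingEnd 𝕜 (v₁.val x)))
  + (∫ x in Ω, ((c.D₂ : 𝕜) * ∑ i, φ₂.grad i x * starRingEnd 𝕜 (v₂.grad i x)
      + (c.Sa₂ : 𝕜) * φ₂.val x * starRingEnd 𝕜 (v₂.val x)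
      - (c.S₁₂ : 𝕜) * φ₁.val x * starRingEnd 𝕜 (v₂.val x)))
  + ∫ x, ((c.α₁ : 𝕜) * g₁ x * starRingEnd 𝕜 (h₁ x)
      + (c.α₂ : 𝕜) * g₂ x * starRingEnd 𝕜 (h₂ x)) ∂(surfaceMeasure Ω)

/-- The sesquilinear form `b((f₁, f₂), (v₁, v₂))`; it does not involve `v₂`. -/
noncomputable def formB {d : ℕ} {Ω : Set (EuclideanSpace ℝ (Fin d))} {𝕜 : Type*} [RCLike 𝕜]
    (c : Coefficients) (f₁ f₂ v₁ _v₂ : L2 Ω 𝕜) : 𝕜 :=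
  ∫ x in Ω, ((c.nuSf₁ : 𝕜) * f₁ x + (c.nuSf₂ : 𝕜) * f₂ x) * starRingEnd 𝕜 (v₁ x)

/-- `(φ₁, φ₂)` solves the source problem: `a((φ₁, φ₂), (v₁, v₂)) = b((f₁, f₂), (v₁, v₂))` for all
`(v₁, v₂) ∈ H¹(Ω) × H¹(Ω)`. -/
def IsSourceSolution {d : ℕ} {Ω : Set (EuclideanSpace ℝ (Fin d))} {𝕜 : Type*} [RCLike 𝕜]
    (c : Coefficients) (f₁ f₂ : L2 Ω 𝕜) (φ₁ φ₂ : H1 Ω 𝕜) : Prop :=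
  ∃ g₁ g₂ : BoundaryL2 Ω 𝕜, IsTrace φ₁ g₁ ∧ IsTrace φ₂ g₂ ∧
    ∀ (v₁ v₂ : H1 Ω 𝕜) (h₁ h₂ : BoundaryL2 Ω 𝕜), IsTrace v₁ h₁ → IsTrace v₂ h₂ →
      formA c φ₁ φ₂ g₁ g₂ v₁ v₂ h₁ h₂ = formB c f₁ f₂ v₁.val v₂.val

/-- `(φ₁, φ₂)` solves the adjoint source problem:
`a((v₁, v₂), (φ₁, φ₂)) = b((v₁, v₂), (f₁, f₂))` for all `(v₁, v₂) ∈ H¹(Ω) × H¹(Ω)`. -/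
def IsAdjointSolution {d : ℕ} {Ω : Set (EuclideanSpace ℝ (Fin d))} {𝕜 : Type*} [RCLike 𝕜]
    (c : Coefficients) (f₁ f₂ : L2 Ω 𝕜) (φ₁ φ₂ : H1 Ω 𝕜) : Prop :=
  ∃ g₁ g₂ : BoundaryL2 Ω 𝕜, IsTrace φ₁ g₁ ∧ IsTrace φ₂ g₂ ∧
    ∀ (v₁ v₂ : H1 Ω 𝕜) (h₁ h₂ : BoundaryL2 Ω 𝕜), IsTrace v₁ h₁ → IsTrace v₂ h₂ →
      formA c v₁ v₂ h₁ h₂ φ₁ φ₂ g₁ g₂ = formB c v₁.val v₂.val f₁ f₂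

end TwoGroup

/-! Scattering couples the two groups in one direction only, so both problems are triangular. In the
source problem the first group is solved alone and feeds `S₁₂ φ₁` into the second; in the adjoint
problem the second group is solved alone and feeds the first (`isSourceSolution_iff`,
`isAdjointSolution_iff`). Everything thus reduces to a scalar problem with a Hermitian energy, and
the system estimates follow by chaining the scalar bound `IsSolution.norm_le`, obtained by testing
with the solution itself.

The scalar problem is solved by Lax–Milgram (`exists_isSolution`) in the closed space `traceGraph`
of limits of triples (ψ, ∇ψ, ψ on ∂Ω) with ψ smooth. Its elements are exactly the pairs of an `H1`
function and a trace, so neither density of smooth functions in H¹ nor uniqueness of traces has to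
be proved. Coercivity in the norm that includes the boundary component is the trace inequality
`exists_trace_le`: near a boundary point, ψ is integrated along segments entering Ω transversally to
a Lipschitz graph, and finitely many such neighbourhoods cover ∂Ω. -/

namespace TwoGroup

/-! ### The trace inequality for functions that are C¹ up to the boundary -/

section TraceInequality

variable {𝕜 : Type*} [RCLike 𝕜]

/-- A function on `[0, δ]` is controlled at the endpoint `0` by its `H¹` norm along a ray. -/
lemma enorm_sq_le_lintegral_ray {E : Type*} [NormedAddCommGroup E] [NormedSpace ℝ E]
    {ψ : E → 𝕜} (hψ : ContDiff ℝ 1 ψ) (y e : E) {δ : ℝ} (hδ : 0 < δ) :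
    ‖ψ y‖ₑ ^ 2 ≤ ENNReal.ofReal (1 / δ + 1) *
      ∫⁻ t in Set.Ioc 0 δ, (‖ψ (y + t • e)‖ₑ ^ 2 + ‖fderiv ℝ ψ (y + t • e) e‖ₑ ^ 2) := by
  have hray : Continuous fun t : ℝ => y + t • e := by fun_prop
  have hc1 : Continuous fun t : ℝ => ψ (y + t • e) := hψ.continuous.comp hray
  have hc2 : Continuous fun t : ℝ => fderiv ℝ ψ (y + t • e) e :=
    ((hψ.continuous_fderiv one_ne_zero).comp hray).clm_apply continuous_const
  have hd (t : ℝ) : HasDerivAt (fun t : ℝ => ψ (y + t • e)) (fderiv ℝ ψ (y + t • e) e) t := by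
    have h1 : HasDerivAt (fun t : ℝ => y + t • e) e t := by
      simpa using ((hasDerivAt_id t).smul_const e).const_add y
    exact ((hψ.differentiable one_ne_zero) (y + t • e)).hasFDerivAt.comp_hasDerivAt t h1
  -- The weight `1 - t / δ` is 1 at `t = 0` and 0 at `t = δ`, so the fundamental theorem of calculus
  -- leaves only the value at `y`.
  have hd2 (t : ℝ) : HasDerivAt (fun t : ℝ => (1 - t / δ) * ‖ψ (y + t • e)‖ ^ 2)
      (-(1 / δ) * ‖ψ (y + t • e)‖ ^ 2 +
        (1 - t / δ) * (2 * inner ℝ (ψ (y + t • e)) (fderiv ℝ ψ (y + t • e) e))) t := by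
    have h1 : HasDerivAt (fun t : ℝ => 1 - t / δ) (-(1 / δ)) t := by
      simpa using ((hasDerivAt_id t).div_const δ).const_sub 1
    exact h1.mul (hd t).norm_sq
  have hint : ∫ t in (0)..δ, (-(1 / δ) * ‖ψ (y + t • e)‖ ^ 2 +
      (1 - t / δ) * (2 * inner ℝ (ψ (y + t • e)) (fderiv ℝ ψ (y + t • e) e)))
      = -‖ψ y‖ ^ 2 := by
    rw [intervalIntegral.integral_eq_sub_of_hasDerivAt (fun t _ => hd2 t)]
    · simp [hδ.ne']
    · exact Continuous.intervalIntegrable (by fun_prop) _ _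
  have hle : ‖ψ y‖ ^ 2 ≤ ∫ t in (0)..δ, (1 / δ + 1) *
      (‖ψ (y + t • e)‖ ^ 2 + ‖fderiv ℝ ψ (y + t • e) e‖ ^ 2) := by
    rw [← neg_neg (‖ψ y‖ ^ 2), ← hint, ← intervalIntegral.integral_neg]
    refine intervalIntegral.integral_mono_on hδ.le
      (Continuous.intervalIntegrable (by fun_prop) _ _)
      (Continuous.intervalIntegrable (by fun_prop) _ _) fun t ht => ?_
    have h0 : 0 ≤ 1 - t / δ := by
      rw [sub_nonneg, div_le_one hδ]; exact ht.2
    have h1 : 1 - t / δ ≤ 1 := by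
      have := div_nonneg ht.1 hδ.le; linarith
    have h2 := abs_real_inner_le_norm (ψ (y + t • e)) (fderiv ℝ ψ (y + t • e) e)
    have h3 := neg_abs_le (inner ℝ (ψ (y + t • e)) (fderiv ℝ ψ (y + t • e) e))
    set a := ‖ψ (y + t • e)‖
    set b := ‖fderiv ℝ ψ (y + t • e) e‖
    set q : ℝ := inner ℝ (ψ (y + t • e)) (fderiv ℝ ψ (y + t • e) e)
    have h4 : -(2 * q) ≤ a ^ 2 + b ^ 2 := by nlinarith [sq_nonneg (a - b)]
    have h5 : (1 - t / δ) * (-(2 * q)) ≤ a ^ 2 + b ^ 2 :=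
      (mul_le_mul_of_nonneg_left h4 h0).trans
        (mul_le_of_le_one_left (by positivity) h1)
    have h6 : 0 ≤ 1 / δ * b ^ 2 := by positivity
    linarith
  have hnn (z : 𝕜) : ‖z‖ₑ ^ 2 = ENNReal.ofReal (‖z‖ ^ 2) := by
    rw [ENNReal.ofReal_pow (norm_nonneg _), ofReal_norm]
  rw [hnn]
  refine (ENNReal.ofReal_le_ofReal hle).trans ?_
  rw [intervalIntegral.integral_const_mul, ENNReal.ofReal_mul (by positivity),
    intervalIntegral.integral_of_le hδ.le, ofReal_integral_eq_lintegral_ofReal]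
  · refine le_of_eq (congrArg _ (lintegral_congr fun t => ?_))
    rw [ENNReal.ofReal_add (by positivity) (by positivity), hnn, hnn]
  · exact (Continuous.integrableOn_Icc (by fun_prop)).mono_set Set.Ioc_subset_Icc_self
  · exact Eventually.of_forall fun t => by positivity

/-- Coordinates adapted to a unit vector `e`: the hyperplane `eᗮ` is parametrised linearly by `L`,
and `P` reads off the coordinates of the orthogonal projection. -/
lemma exists_frame {n : ℕ} (e : EuclideanSpace ℝ (Fin (n + 1))) (he : ‖e‖ = 1) :
    ∃ (L : (Fin n → ℝ) →L[ℝ] EuclideanSpace ℝ (Fin (n + 1)))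
      (P : EuclideanSpace ℝ (Fin (n + 1)) → (Fin n → ℝ)),
      (∀ y, L (P y) = y - inner ℝ e y • e) ∧
      MeasurePreserving (fun p : ℝ × (Fin n → ℝ) => L p.2 + p.1 • e) volume volume := by
  obtain ⟨b, hb⟩ : ∃ b : OrthonormalBasis (Fin (n + 1)) ℝ (EuclideanSpace ℝ (Fin (n + 1))),
      b 0 = e := by
    have hv : Orthonormal ℝ (({0} : Set (Fin (n + 1))).domRestrict fun _ => e) := by
      refine ⟨fun i => he, fun i j hij => absurd (Subsingleton.elim i j) hij⟩
    obtain ⟨b, hb⟩ := hv.exists_orthonormalBasis_extension_of_card_eq (by simp)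
    exact ⟨b, hb 0 rfl⟩
  refine ⟨∑ i, (ContinuousLinearMap.proj i).smulRight (b i.succ),
    fun y i => inner ℝ (b i.succ) y, fun y => ?_, ?_⟩
  · rw [eq_sub_iff_add_eq, sum_apply]
    conv_rhs => rw [← b.sum_repr' y, Fin.sum_univ_succ, hb]
    exact add_comm _ _
  · have h := (b.measurePreserving_repr_symm.comp (PiLp.volume_preserving_toLp (Fin (n + 1)))).comp
      (volume_preserving_piFinSuccAbove (fun _ : Fin (n + 1) => ℝ) 0).symm
    refine (congrArg (MeasurePreserving · volume volume) (funext fun p => ?_)).mpr h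
    rw [Function.comp_apply, Function.comp_apply, sum_apply]
    rw [← b.sum_repr_symm, Fin.sum_univ_succ, hb]
    simp [MeasurableEquiv.piFinSuccAbove, add_comm]

/-- The Hausdorff measure on a Lipschitz graph over the hyperplane `eᗮ` is dominated by the image
of Lebesgue measure. -/
lemma hausdorffMeasure_restrict_graph_le {n : ℕ} {e : EuclideanSpace ℝ (Fin (n + 1))}
    {L : (Fin n → ℝ) →L[ℝ] EuclideanSpace ℝ (Fin (n + 1))}
    {P : EuclideanSpace ℝ (Fin (n + 1)) → (Fin n → ℝ)}
    (hLP : ∀ y, L (P y) = y - inner ℝ e y • e)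
    {K : NNReal} {γ : EuclideanSpace ℝ (Fin (n + 1)) → ℝ} (hγ : LipschitzWith K γ)
    {S : Set (EuclideanSpace ℝ (Fin (n + 1)))}
    (hS : ∀ y ∈ S, γ (y - inner ℝ e y • e) = inner ℝ e y) :
    ∃ C : ENNReal, C ≠ ⊤ ∧
      (Measure.euclideanHausdorffMeasure n).restrict S ≤
        C • Measure.map (fun z => L z + γ (L z) • e) volume := by
  obtain ⟨M, hM⟩ : ∃ M, LipschitzWith M (fun z => L z + γ (L z) • e) :=
    ⟨_, L.lipschitz.add
      (((ContinuousLinearMap.id ℝ ℝ).smulRight e).lipschitz.comp (hγ.comp L.lipschitz))⟩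
  set G : (Fin n → ℝ) → EuclideanSpace ℝ (Fin (n + 1)) := fun z => L z + γ (L z) • e with hG
  rw [Measure.euclideanHausdorffMeasure_def]
  set k := Measure.addHaarScalarFactor (volume : Measure (EuclideanSpace ℝ (Fin n)))
    (Measure.hausdorffMeasure n)
  -- `k` is the factor normalising Hausdorff measure; `M ^ n` is the largest factor by which an
  -- `M`-Lipschitz map increases it.
  refine ⟨k * (M : ENNReal) ^ (n : ℝ), by finiteness, Measure.le_intro fun A hA _ => ?_⟩
  rw [Measure.restrict_apply hA, Measure.smul_apply, Measure.smul_apply,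
    Measure.map_apply hM.continuous.measurable hA, ENNReal.smul_def, smul_eq_mul, smul_eq_mul,
    mul_assoc]
  refine mul_le_mul_right ?_ _
  have hsub : A ∩ S ⊆ G '' (G ⁻¹' A) := by
    rintro y ⟨hyA, hyS⟩
    have hy : G (P y) = y := by
      simp only [hG, hLP, hS y hyS, sub_add_cancel]
    exact ⟨P y, by rwa [Set.mem_preimage, hy], hy⟩
  refine (measure_mono hsub).trans ?_
  have h := hM.hausdorffMeasure_image_le (d := n) (Nat.cast_nonneg n) (G ⁻¹' A)
  -- In the sup metric of `Fin n → ℝ` the `n`-dimensional Hausdorff measure is exactly Lebesgue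
  -- measure.
  have hv := hausdorffMeasure_pi_real (ι := Fin n)
  rw [Fintype.card_fin] at hv
  rwa [hv] at h

/-- Tonelli in the frame coordinates: for fixed `z`, starting the ray on the graph only translates
`t` by `γ (L z)`, which preserves Lebesgue measure. The segments issuing from the graph therefore
sweep out space without overlap. -/
lemma lintegral_graph_le {n : ℕ} {e : EuclideanSpace ℝ (Fin (n + 1))}
    {L : (Fin n → ℝ) →L[ℝ] EuclideanSpace ℝ (Fin (n + 1))}
    (hL : MeasurePreserving (fun p : ℝ × (Fin n → ℝ) => L p.2 + p.1 • e) volume volume)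
    {γ : EuclideanSpace ℝ (Fin (n + 1)) → ℝ}
    {h : EuclideanSpace ℝ (Fin (n + 1)) → ENNReal} (hh : Measurable h) (s : Set ℝ) :
    ∫⁻ z, ∫⁻ t in s, h (L z + γ (L z) • e + t • e) ≤ ∫⁻ x, h x := by
  rw [← hL.lintegral_comp hh, Measure.volume_eq_prod,
    lintegral_prod_symm (fun p : ℝ × (Fin n → ℝ) => h (L p.2 + p.1 • e)) ((hh.comp hL.measurable).aemeasurable)]
  refine lintegral_mono fun z => (setLIntegral_le_lintegral _ _).trans (le_of_eq ?_)
  rw [← lintegral_add_left_eq_self (fun t => h (L z + t • e)) (γ (L z))]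
  simp only [add_smul, add_assoc]

lemma enorm_fderiv_apply_sq_le {d : ℕ} (ψ : EuclideanSpace ℝ (Fin d) → 𝕜)
    (x e : EuclideanSpace ℝ (Fin d)) (he : ‖e‖ = 1) :
    ‖fderiv ℝ ψ x e‖ₑ ^ 2 ≤ ∑ i, ‖partialDeriv i ψ x‖ₑ ^ 2 := by
  have h1 : fderiv ℝ ψ x e = ∑ i, e i • partialDeriv i ψ x := by
    conv_lhs => rw [← (EuclideanSpace.basisFun (Fin d) ℝ).sum_repr e]
    simp [partialDeriv, map_sum]
  have h2 : ‖fderiv ℝ ψ x e‖ ^ 2 ≤ ∑ i, ‖partialDeriv i ψ x‖ ^ 2 := by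
    have h3 : ‖fderiv ℝ ψ x e‖ ≤ ∑ i, ‖e i‖ * ‖partialDeriv i ψ x‖ := by
      rw [h1]
      exact (norm_sum_le _ _).trans (le_of_eq (by simp [norm_smul]))
    have h4 : ∑ i, ‖e i‖ ^ 2 = 1 := by rw [← EuclideanSpace.norm_sq_eq, he, one_pow]
    calc _ ≤ (∑ i, ‖e i‖ * ‖partialDeriv i ψ x‖) ^ 2 := by gcongr
      _ ≤ _ := Finset.sum_mul_sq_le_sq_mul_sq _ _ _
      _ = _ := by rw [h4, one_mul]
  have hnn (z : 𝕜) : ‖z‖ₑ ^ 2 = ENNReal.ofReal (‖z‖ ^ 2) := by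
    rw [ENNReal.ofReal_pow (norm_nonneg _), ofReal_norm]
  simp only [hnn]
  rw [← ENNReal.ofReal_sum_of_nonneg fun i _ => by positivity]
  exact ENNReal.ofReal_le_ofReal h2

lemma continuous_partialDeriv {d : ℕ} {ψ : EuclideanSpace ℝ (Fin d) → 𝕜} (hψ : ContDiff ℝ 1 ψ)
    (i : Fin d) : Continuous (partialDeriv i ψ) :=
  (hψ.continuous_fderiv one_ne_zero).clm_apply continuous_const

/-- The local trace inequality. -/
lemma exists_local_trace_le {n : ℕ} {Ω : Set (EuclideanSpace ℝ (Fin (n + 1)))}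
    (hΩ : IsBoundedLipschitzDomain Ω) {x : EuclideanSpace ℝ (Fin (n + 1))} (hx : x ∈ frontier Ω) :
    ∃ δ : ℝ, 0 < δ ∧ ∃ C : ENNReal, C ≠ ⊤ ∧
      ∀ ψ : EuclideanSpace ℝ (Fin (n + 1)) → 𝕜, ContDiff ℝ 1 ψ →
        ∫⁻ y in frontier Ω ∩ Metric.ball x δ, ‖ψ y‖ₑ ^ 2 ∂(Measure.euclideanHausdorffMeasure n) ≤
          C * ∫⁻ y in Ω, (‖ψ y‖ₑ ^ 2 + ∑ i, ‖partialDeriv i ψ y‖ₑ ^ 2) := by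
  obtain ⟨r, hr, e, he, K, γ, hγ, hball⟩ := hΩ.lipschitz_boundary x hx
  obtain ⟨L, P, hLP, hL⟩ := exists_frame e he
  have hee : inner ℝ e e = (1 : ℝ) := by rw [real_inner_self_eq_norm_sq, he, one_pow]
  have hcγ : Continuous γ := hγ.continuous
  have hgraph : ∀ y ∈ frontier Ω ∩ Metric.ball x (r / 2),
      γ (y - inner ℝ e y • e) = inner ℝ e y := by
    rintro y ⟨hy, hyx⟩
    have hyr : y ∈ Metric.ball x r := Metric.ball_subset_ball (by linarith) hyx
    -- A point strictly below the graph has a neighbourhood missing Ω, so it is not in the closure;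
    -- a point strictly above lies in Ω, which is open and hence disjoint from its frontier.
    refine le_antisymm ?_ ?_
    · by_contra! hlt
      have hopen : IsOpen {w : EuclideanSpace ℝ (Fin (n + 1)) |
          inner ℝ e w < γ (w - inner ℝ e w • e)} :=
        isOpen_lt (by fun_prop) (by fun_prop)
      obtain ⟨w, ⟨hw1, hw2⟩, hw3⟩ := mem_closure_iff.1 (frontier_subset_closure hy) _
        (hopen.inter Metric.isOpen_ball) ⟨hlt, hyr⟩
      exact lt_asymm hw1 ((hball w hw2).1 hw3)
    · by_contra! hlt
      have := (hball y hyr).2 hlt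
      rw [hΩ.isOpen.frontier_eq] at hy
      exact hy.2 this
  obtain ⟨C, hC, hle⟩ := hausdorffMeasure_restrict_graph_le hLP hγ hgraph
  have hG : Continuous fun z => L z + γ (L z) • e := by fun_prop
  have hSm : MeasurableSet (frontier Ω ∩ Metric.ball x (r / 2)) :=
    isClosed_frontier.measurableSet.inter measurableSet_ball
  -- Half the radius goes to the distance from `x` to `y`, half to the length of the segment from
  -- `y`, which then stays in the ball where the graph description holds.
  refine ⟨r / 2, by positivity, C * ENNReal.ofReal (1 / (r / 2) + 1), by finiteness,
    fun ψ hψ => ?_⟩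
  set S := frontier Ω ∩ Metric.ball x (r / 2) with hS
  set f : EuclideanSpace ℝ (Fin (n + 1)) → ENNReal :=
    fun y => ‖ψ y‖ₑ ^ 2 + ∑ i, ‖partialDeriv i ψ y‖ₑ ^ 2 with hf
  have hfm : Measurable f := by
    have h1 := hψ.continuous.measurable
    have h2 := fun i => (continuous_partialDeriv hψ i).measurable
    fun_prop
  have hmemΩ : ∀ y ∈ S, ∀ t ∈ Set.Ioc 0 (r / 2), y + t • e ∈ Ω := by
    intro y hy t ht
    have hb : y + t • e ∈ Metric.ball x r := by
      rw [Metric.mem_ball]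
      have h1 : dist (y + t • e) y = t := by
        rw [dist_eq_norm, add_sub_cancel_left, norm_smul, he, mul_one, Real.norm_of_nonneg ht.1.le]
      have h2 := Metric.mem_ball.1 hy.2
      have h3 := dist_triangle (y + t • e) y x
      have h4 := ht.2
      linarith
    rw [hball _ hb]
    have h1 : inner ℝ e (y + t • e) = inner ℝ e y + t := by
      rw [inner_add_right, inner_smul_right, hee, mul_one]
    have h2 : y + t • e - (inner ℝ e y + t) • e = y - inner ℝ e y • e := by
      rw [add_smul]; abel
    rw [h1, h2, hgraph y hy]
    linarith [ht.1]
  -- The indicators make the bound valid at every point, so that it can be integrated over the whole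
  -- graph and not only over the part in `S`.
  have hptw : ∀ y, S.indicator (fun y => ‖ψ y‖ₑ ^ 2) y ≤ ENNReal.ofReal (1 / (r / 2) + 1) *
      ∫⁻ t in Set.Ioc 0 (r / 2), Ω.indicator f (y + t • e) := by
    intro y
    by_cases hy : y ∈ S
    · rw [Set.indicator_of_mem hy]
      refine (enorm_sq_le_lintegral_ray hψ y e (half_pos hr)).trans (mul_le_mul_right ?_ _)
      refine setLIntegral_mono_ae' measurableSet_Ioc (Eventually.of_forall fun t ht => ?_)
      rw [Set.indicator_of_mem (hmemΩ y hy t ht)]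
      exact add_le_add_right (enorm_fderiv_apply_sq_le ψ _ e he) _
    · rw [Set.indicator_of_notMem hy]; exact zero_le
  have hfΩ : Measurable (Ω.indicator f) := hfm.indicator hΩ.isOpen.measurableSet
  have hψm : Measurable (S.indicator fun y => ‖ψ y‖ₑ ^ 2) := by
    have h1 := hψ.continuous.measurable
    exact Measurable.indicator (by fun_prop) hSm
  calc ∫⁻ y in S, ‖ψ y‖ₑ ^ 2 ∂(Measure.euclideanHausdorffMeasure n)
      = ∫⁻ y in S, S.indicator (fun y => ‖ψ y‖ₑ ^ 2) y ∂(Measure.euclideanHausdorffMeasure n) :=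
        setLIntegral_congr_fun hSm fun y hy => by rw [Set.indicator_of_mem hy]
    _ ≤ ∫⁻ y, S.indicator (fun y => ‖ψ y‖ₑ ^ 2) y
          ∂(C • Measure.map (fun z => L z + γ (L z) • e) volume) := lintegral_mono' hle le_rfl
    _ = C * ∫⁻ z, S.indicator (fun y => ‖ψ y‖ₑ ^ 2) (L z + γ (L z) • e) := by
        rw [lintegral_smul_measure, lintegral_map hψm hG.measurable, smul_eq_mul]
    _ ≤ C * ∫⁻ z, ENNReal.ofReal (1 / (r / 2) + 1) *
          ∫⁻ t in Set.Ioc 0 (r / 2), Ω.indicator f (L z + γ (L z) • e + t • e) :=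
        mul_le_mul_right (lintegral_mono fun z => hptw _) _
    _ = C * (ENNReal.ofReal (1 / (r / 2) + 1) *
          ∫⁻ z, ∫⁻ t in Set.Ioc 0 (r / 2), Ω.indicator f (L z + γ (L z) • e + t • e)) := by
        rw [lintegral_const_mul' _ _ ENNReal.ofReal_ne_top]
    _ ≤ C * (ENNReal.ofReal (1 / (r / 2) + 1) * ∫⁻ y, Ω.indicator f y) :=
        mul_le_mul_right (mul_le_mul_right (lintegral_graph_le hL hfΩ _) _) _
    _ = _ := by rw [lintegral_indicator hΩ.isOpen.measurableSet, mul_assoc]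

/-- The trace inequality on a bounded Lipschitz domain, for functions that are `C¹` up to the
boundary. -/
theorem exists_trace_le {d : ℕ} (hd : d ≠ 0) {Ω : Set (EuclideanSpace ℝ (Fin d))}
    (hΩ : IsBoundedLipschitzDomain Ω) (𝕜 : Type*) [RCLike 𝕜] :
    ∃ C : ENNReal, C ≠ ⊤ ∧
      ∀ ψ : EuclideanSpace ℝ (Fin d) → 𝕜, ContDiff ℝ 1 ψ →
        ∫⁻ y, ‖ψ y‖ₑ ^ 2 ∂(surfaceMeasure Ω) ≤
          C * ∫⁻ y in Ω, (‖ψ y‖ₑ ^ 2 + ∑ i, ‖partialDeriv i ψ y‖ₑ ^ 2) := by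
  obtain ⟨n, rfl⟩ := Nat.exists_eq_succ_of_ne_zero hd
  choose! δ hδ C hC hle using fun x (hx : x ∈ frontier Ω) =>
    exists_local_trace_le (𝕜 := 𝕜) hΩ hx
  have hcpt : IsCompact (frontier Ω) := Metric.isCompact_of_isClosed_isBounded isClosed_frontier
    (hΩ.isBounded.closure.subset frontier_subset_closure)
  obtain ⟨T, hT, hcov⟩ := hcpt.elim_nhds_subcover (fun x => Metric.ball x (δ x))
    fun x hx => Metric.ball_mem_nhds x (hδ x hx)
  refine ⟨∑ x ∈ T, C x, ?_, fun ψ hψ => ?_⟩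
  · exact ENNReal.sum_ne_top.2 fun x hx => hC x (hT x hx)
  have hsub : frontier Ω ⊆ ⋃ x : T, frontier Ω ∩ Metric.ball x.1 (δ x.1) := fun y hy => by
    obtain ⟨x, hx, hxy⟩ := Set.mem_iUnion₂.1 (hcov hy)
    exact Set.mem_iUnion.2 ⟨⟨x, hx⟩, hy, hxy⟩
  rw [surfaceMeasure, Finset.sum_mul]
  refine (lintegral_mono_set hsub).trans ((lintegral_iUnion_le _ _).trans ?_)
  rw [tsum_fintype, Finset.sum_coe_sort T fun x => ∫⁻ y in frontier Ω ∩ Metric.ball x (δ x),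
    ‖ψ y‖ₑ ^ 2 ∂(Measure.euclideanHausdorffMeasure (n.succ - 1))]
  exact Finset.sum_le_sum fun x hx => hle x (hT x hx) ψ hψ

end TraceInequality

end TwoGroup

namespace TwoGroup

/-! ### The graph of the trace operator as a Hilbert space -/

section TraceSpace

variable {d : ℕ} {Ω : Set (EuclideanSpace ℝ (Fin d))} {𝕜 : Type*} [RCLike 𝕜]

/-- The Hilbert space of triples (function, gradient, boundary values). -/
abbrev TripleSpace (Ω : Set (EuclideanSpace ℝ (Fin d))) (𝕜 : Type*) [RCLike 𝕜] :=
  WithLp 2 (L2 Ω 𝕜 × WithLp 2 (PiLp 2 (fun _ : Fin d => L2 Ω 𝕜) × BoundaryL2 Ω 𝕜))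

/-- The triple formed by `u ∈ H¹(Ω)`, its gradient and `g ∈ L²(∂Ω)`. -/
noncomputable def triple (u : H1 Ω 𝕜) (g : BoundaryL2 Ω 𝕜) : TripleSpace Ω 𝕜 :=
  WithLp.toLp 2 (u.val, WithLp.toLp 2 (WithLp.toLp 2 u.grad, g))

/-- The triples that come from functions smooth up to the boundary. -/
def smoothTriples (Ω : Set (EuclideanSpace ℝ (Fin d))) (𝕜 : Type*) [RCLike 𝕜] :
    Submodule 𝕜 (TripleSpace Ω 𝕜) where
  carrier := {w | ∃ ψ : EuclideanSpace ℝ (Fin d) → 𝕜, ContDiff ℝ ∞ ψ ∧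
    w.fst =ᵐ[volume.restrict Ω] ψ ∧
    (∀ i, w.snd.fst i =ᵐ[volume.restrict Ω] partialDeriv i ψ) ∧
    w.snd.snd =ᵐ[surfaceMeasure Ω] ψ}
  zero_mem' := ⟨0, contDiff_const, Lp.coeFn_zero _ _ _, fun i => by
    filter_upwards [Lp.coeFn_zero 𝕜 2 (volume.restrict Ω)] with x hx
    simpa [partialDeriv] using hx, Lp.coeFn_zero _ _ _⟩
  add_mem' := by
    rintro w z ⟨ψ, hψ, h1, h2, h3⟩ ⟨φ, hφ, k1, k2, k3⟩
    refine ⟨ψ + φ, hψ.add hφ, (Lp.coeFn_add _ _).trans (h1.add k1), fun i => ?_,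
      (Lp.coeFn_add _ _).trans (h3.add k3)⟩
    refine (Lp.coeFn_add _ _).trans (((h2 i).add (k2 i)).trans (Eventually.of_forall fun x => ?_))
    simp only [Pi.add_apply, partialDeriv]
    rw [fderiv_add (hψ.differentiable (by simp) x) (hφ.differentiable (by simp) x)]
    rfl
  smul_mem' := by
    rintro c w ⟨ψ, hψ, h1, h2, h3⟩
    refine ⟨c • ψ, hψ.const_smul c, (Lp.coeFn_smul _ _).trans (h1.const_smul c), fun i => ?_,
      (Lp.coeFn_smul _ _).trans (h3.const_smul c)⟩
    refine (Lp.coeFn_smul _ _).trans (((h2 i).const_smul c).trans (Eventually.of_forall fun x => ?_))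
    simp only [Pi.smul_apply, partialDeriv]
    rw [fderiv_const_smul (hψ.differentiable (by simp) x)]
    rfl

/-- The graph of the trace operator. -/
noncomputable def traceGraph (Ω : Set (EuclideanSpace ℝ (Fin d))) (𝕜 : Type*) [RCLike 𝕜] :
    Submodule 𝕜 (TripleSpace Ω 𝕜) :=
  (smoothTriples Ω 𝕜).topologicalClosure

instance : CompleteSpace (traceGraph Ω 𝕜) :=
  (Submodule.isClosed_topologicalClosure _).completeSpace_coe

lemma memLp_of_eLpNorm_sub_lt_top {α : Type*} [MeasurableSpace α] {μ : Measure α} {f : α → 𝕜}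
    {u : Lp 𝕜 2 μ} (hf : AEStronglyMeasurable f μ)
    (h : eLpNorm (fun x => f x - u x) 2 μ < ⊤) : MemLp f 2 μ := by
  have h1 : MemLp (fun x => f x - u x) 2 μ := ⟨hf.sub (Lp.aestronglyMeasurable u), h⟩
  refine (h1.add (Lp.memLp u)).congr_norm hf (Eventually.of_forall fun x => ?_)
  simp

lemma tendsto_toLp {α : Type*} [MeasurableSpace α] {μ : Measure α} {f : ℕ → α → 𝕜}
    {u : Lp 𝕜 2 μ} (hf : ∀ n, MemLp (f n) 2 μ)
    (h : Tendsto (fun n => eLpNorm (fun x => f n x - u x) 2 μ) atTop (𝓝 0)) :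
    Tendsto (fun n => (hf n).toLp (f n)) atTop (𝓝 u) := by
  rw [Lp.tendsto_Lp_iff_tendsto_eLpNorm']
  refine h.congr fun n => eLpNorm_congr_ae ?_
  exact ((hf n).coeFn_toLp.symm.sub EventuallyEq.rfl)

lemma tendsto_eLpNorm_sub {α : Type*} [MeasurableSpace α] {μ : Measure α} {f : ℕ → α → 𝕜}
    {w : ℕ → Lp 𝕜 2 μ} {u : Lp 𝕜 2 μ} (hf : ∀ n, w n =ᵐ[μ] f n)
    (h : Tendsto w atTop (𝓝 u)) :
    Tendsto (fun n => eLpNorm (fun x => f n x - u x) 2 μ) atTop (𝓝 0) := by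
  rw [Lp.tendsto_Lp_iff_tendsto_eLpNorm'] at h
  exact h.congr fun n => eLpNorm_congr_ae ((hf n).sub EventuallyEq.rfl)

/-- The three limits in `IsTrace` together are convergence in the norm of `TripleSpace`, and in a
metric space the closure consists of the limits of sequences. -/
lemma triple_mem_traceGraph_iff {u : H1 Ω 𝕜} {g : BoundaryL2 Ω 𝕜} :
    triple u g ∈ traceGraph Ω 𝕜 ↔ IsTrace u g := by
  constructor
  · intro h
    obtain ⟨w, hw, hlim⟩ := mem_closure_iff_seq_limit.1 h
    choose ψ hψ h1 h2 h3 using hw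
    have l1 : Tendsto (fun n => (w n).fst) atTop (𝓝 u.val) :=
      ((WithLp.prod_continuous_ofLp 2 _ _).fst.tendsto (triple u g)).comp hlim
    have l2 : Tendsto (fun n => (w n).snd) atTop (𝓝 (triple u g).snd) :=
      ((WithLp.prod_continuous_ofLp 2 _ _).snd.tendsto (triple u g)).comp hlim
    have l3 : Tendsto (fun n => (w n).snd.snd) atTop (𝓝 g) :=
      ((WithLp.prod_continuous_ofLp 2 _ _).snd.tendsto (triple u g).snd).comp l2
    have l4 : Tendsto (fun n => (w n).snd.fst) atTop (𝓝 (triple u g).snd.fst) :=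
      ((WithLp.prod_continuous_ofLp 2 _ _).fst.tendsto (triple u g).snd).comp l2
    have l5 (i : Fin d) : Tendsto (fun n => (w n).snd.fst i) atTop (𝓝 (u.grad i)) :=
      (((continuous_apply i).comp (PiLp.continuous_ofLp 2 _)).tendsto _).comp l4
    exact ⟨ψ, hψ, tendsto_eLpNorm_sub h1 l1, fun i => tendsto_eLpNorm_sub (fun n => h2 n i) (l5 i),
      tendsto_eLpNorm_sub h3 l3⟩
  · rintro ⟨ψ, hψ, h1, h2, h3⟩
    have hcd (n : ℕ) : ContDiff ℝ 1 (ψ n) := (hψ n).of_le (by exact_mod_cast le_top)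
    -- `IsTrace` does not require each `ψ n` to be square-integrable. This holds once its distance
    -- to the limit is finite, hence from some index `N` on.
    obtain ⟨N, hN⟩ := eventually_atTop.1 (((h1.eventually_lt_const ENNReal.zero_lt_top).and
      (eventually_all.2 fun i => (h2 i).eventually_lt_const ENNReal.zero_lt_top)).and
      (h3.eventually_lt_const ENNReal.zero_lt_top))
    have m1 (n : ℕ) : MemLp (ψ (n + N)) 2 (volume.restrict Ω) :=
      memLp_of_eLpNorm_sub_lt_top (hcd _).continuous.aestronglyMeasurable
        (hN (n + N) (Nat.le_add_left _ _)).1.1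
    have m2 (i : Fin d) (n : ℕ) : MemLp (partialDeriv i (ψ (n + N))) 2 (volume.restrict Ω) :=
      memLp_of_eLpNorm_sub_lt_top (continuous_partialDeriv (hcd _) i).aestronglyMeasurable
        ((hN (n + N) (Nat.le_add_left _ _)).1.2 i)
    have m3 (n : ℕ) : MemLp (ψ (n + N)) 2 (surfaceMeasure Ω) :=
      memLp_of_eLpNorm_sub_lt_top (hcd _).continuous.aestronglyMeasurable
        (hN (n + N) (Nat.le_add_left _ _)).2
    have l1 := tendsto_toLp m1 ((tendsto_add_atTop_iff_nat N).2 h1)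
    have l2 := fun i => tendsto_toLp (m2 i) ((tendsto_add_atTop_iff_nat N).2 (h2 i))
    have l3 := tendsto_toLp m3 ((tendsto_add_atTop_iff_nat N).2 h3)
    have l4 := ((PiLp.continuous_toLp 2 _).tendsto _).comp (tendsto_pi_nhds.2 l2)
    have l5 := ((WithLp.prod_continuous_toLp 2 _ _).tendsto _).comp (l4.prodMk_nhds l3)
    have l6 := ((WithLp.prod_continuous_toLp 2 _ _).tendsto _).comp (l1.prodMk_nhds l5)
    refine mem_closure_of_tendsto l6 (Eventually.of_forall fun n => ?_)
    exact ⟨ψ (n + N), hψ _, (m1 n).coeFn_toLp, fun i => (m2 i n).coeFn_toLp, (m3 n).coeFn_toLp⟩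

/-- Integration against a continuous compactly supported function is a continuous functional. -/
lemma continuous_integral_smul {ψ : EuclideanSpace ℝ (Fin d) → ℝ} (hψ : Continuous ψ)
    (hc : HasCompactSupport ψ) :
    Continuous fun u : L2 Ω 𝕜 => ∫ x in Ω, ψ x • u x := by
  have hm : MemLp (fun x => (ψ x : 𝕜)) 2 (volume.restrict Ω) :=
    (RCLike.continuous_ofReal.comp hψ).memLp_of_hasCompactSupport
      (hc.comp_left RCLike.ofReal_zero)
  have h (u : L2 Ω 𝕜) : ∫ x in Ω, ψ x • u x = inner 𝕜 (hm.toLp _) u := by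
    rw [L2.inner_def]
    refine integral_congr_ae ?_
    filter_upwards [hm.coeFn_toLp] with x hx
    rw [hx, RCLike.inner_apply, RCLike.conj_ofReal, RCLike.real_smul_eq_coe_mul, mul_comm]
  simp only [h]
  fun_prop

lemma isWeakPartial_partialDeriv {ψ : EuclideanSpace ℝ (Fin d) → 𝕜} (hψ : ContDiff ℝ ∞ ψ)
    (i : Fin d) : IsWeakPartial Ω i ψ (partialDeriv i ψ) := by
  intro φ hφ hc hs
  have hψ1 : ContDiff ℝ 1 ψ := hψ.of_le (by exact_mod_cast le_top)
  have hφ1 : ContDiff ℝ 1 φ := hφ.of_le (by exact_mod_cast le_top)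
  have hc' : HasCompactSupport (partialDeriv i φ) := hc.fderiv_apply ℝ _
  have hcont := continuous_partialDeriv hψ1 i
  have hcont' : Continuous (partialDeriv i φ) :=
    (hφ1.continuous_fderiv one_ne_zero).clm_apply continuous_const
  have h0 : ∀ x, x ∉ Ω → φ x = 0 := fun x hx => image_eq_zero_of_notMem_tsupport fun h => hx (hs h)
  have h0' : ∀ x, x ∉ Ω → partialDeriv i φ x = 0 := fun x hx =>
    image_eq_zero_of_notMem_tsupport fun h => hx (hs ((tsupport_fderiv_apply_subset ℝ _) h))
  -- The test function vanishes off Ω, so both integrals extend to the whole space and no boundary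
  -- term arises. The identity is then turned around to fit integration by parts.
  rw [setIntegral_eq_integral_of_forall_compl_eq_zero fun x hx => by rw [h0' x hx, zero_smul],
    setIntegral_eq_integral_of_forall_compl_eq_zero fun x hx => by rw [h0 x hx, zero_smul],
    eq_neg_iff_add_eq_zero, add_comm, ← eq_neg_iff_add_eq_zero]
  refine integral_smul_fderiv_eq_neg_fderiv_smul_of_integrable ?_ ?_ ?_
    (fun x _ => hφ1.differentiable one_ne_zero x) (fun x _ => hψ1.differentiable one_ne_zero x)
  · exact (hcont'.smul hψ1.continuous).integrable_of_hasCompactSupport hc'.smul_right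
  · exact (hφ1.continuous.smul hcont).integrable_of_hasCompactSupport hc.smul_right
  · exact (hφ1.continuous.smul hψ1.continuous).integrable_of_hasCompactSupport hc.smul_right

/-- For a fixed test function both sides of the defining identity are continuous in the triple, so
it passes from smooth triples to their closure. -/
lemma isWeakPartial_of_mem_traceGraph {w : TripleSpace Ω 𝕜} (hw : w ∈ traceGraph Ω 𝕜)
    (i : Fin d) : IsWeakPartial Ω i w.fst (w.snd.fst i) := by
  intro φ hφ hc hs
  have hφ1 : ContDiff ℝ 1 φ := hφ.of_le (by exact_mod_cast le_top)
  have hcont' : Continuous (partialDeriv i φ) :=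
    (hφ1.continuous_fderiv one_ne_zero).clm_apply continuous_const
  have hc' : HasCompactSupport (partialDeriv i φ) := hc.fderiv_apply ℝ _
  have hp : Continuous fun w : TripleSpace Ω 𝕜 => w.snd.fst i :=
    (continuous_apply i).comp ((PiLp.continuous_ofLp 2 _).comp
      ((WithLp.prod_continuous_ofLp 2 _ _).fst.comp (WithLp.prod_continuous_ofLp 2 _ _).snd))
  have hclosed : IsClosed {w : TripleSpace Ω 𝕜 |
      ∫ x in Ω, partialDeriv i φ x • w.fst x = - ∫ x in Ω, φ x • w.snd.fst i x} :=
    isClosed_eq ((continuous_integral_smul hcont' hc').comp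
      (WithLp.prod_continuous_ofLp 2 _ _).fst)
      ((continuous_integral_smul hφ1.continuous hc).comp hp).neg
  refine closure_minimal (fun z hz => ?_) hclosed hw
  obtain ⟨ψ, hψ, h1, h2, -⟩ := hz
  have h := isWeakPartial_partialDeriv (Ω := Ω) hψ i φ hφ hc hs
  change ∫ x in Ω, partialDeriv i φ x • z.fst x = - ∫ x in Ω, φ x • z.snd.fst i x
  convert h using 1
  · exact integral_congr_ae (by filter_upwards [h1] with x hx; rw [hx])
  · exact congrArg _ (integral_congr_ae (by filter_upwards [h2 i] with x hx; rw [hx]))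

lemma exists_eq_triple {w : TripleSpace Ω 𝕜} (hw : w ∈ traceGraph Ω 𝕜) :
    ∃ u g, IsTrace u g ∧ w = triple u g :=
  ⟨⟨w.fst, w.snd.fst, isWeakPartial_of_mem_traceGraph hw⟩, w.snd.snd,
    triple_mem_traceGraph_iff.1 hw, rfl⟩

lemma enorm_sq_eq_lintegral {α : Type*} [MeasurableSpace α] {μ : Measure α} {f : α → 𝕜}
    {u : Lp 𝕜 2 μ} (h : u =ᵐ[μ] f) : ‖u‖ₑ ^ 2 = ∫⁻ x, ‖f x‖ₑ ^ 2 ∂μ := by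
  rw [Lp.enorm_def, eLpNorm_congr_ae h]
  have := eLpNorm_nnreal_pow_eq_lintegral (f := f) (μ := μ) (p := 2) two_ne_zero
  simpa using this

/-- The trace inequality on the graph of the trace operator. -/
lemma exists_norm_boundary_sq_le (hd : d ≠ 0) (hΩ : IsBoundedLipschitzDomain Ω)
    (𝕜 : Type*) [RCLike 𝕜] :
    ∃ C : ℝ, 0 ≤ C ∧ ∀ w ∈ traceGraph Ω 𝕜,
      ‖w.snd.snd‖ ^ 2 ≤ C * (‖w.fst‖ ^ 2 + ‖w.snd.fst‖ ^ 2) := by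
  obtain ⟨C, hC, hle⟩ := exists_trace_le hd hΩ 𝕜
  refine ⟨C.toReal, ENNReal.toReal_nonneg, fun w hw => ?_⟩
  have p1 : Continuous fun w : TripleSpace Ω 𝕜 => w.fst := (WithLp.prod_continuous_ofLp 2 _ _).fst
  have p2 : Continuous fun w : TripleSpace Ω 𝕜 => w.snd.fst :=
    (WithLp.prod_continuous_ofLp 2 _ _).fst.comp (WithLp.prod_continuous_ofLp 2 _ _).snd
  have p3 : Continuous fun w : TripleSpace Ω 𝕜 => w.snd.snd :=
    (WithLp.prod_continuous_ofLp 2 _ _).snd.comp (WithLp.prod_continuous_ofLp 2 _ _).snd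
  have hclosed : IsClosed {w : TripleSpace Ω 𝕜 |
      ‖w.snd.snd‖ ^ 2 ≤ C.toReal * (‖w.fst‖ ^ 2 + ‖w.snd.fst‖ ^ 2)} :=
    isClosed_le (by fun_prop) (by fun_prop)
  -- The inequality is a closed condition on the triple, so smooth triples suffice.
  refine closure_minimal (fun z hz => ?_) hclosed hw
  obtain ⟨ψ, hψ, h1, h2, h3⟩ := hz
  have hψ1 : ContDiff ℝ 1 ψ := hψ.of_le (by exact_mod_cast le_top)
  have h := hle ψ hψ1
  have hm := fun i => (continuous_partialDeriv hψ1 i).measurable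
  have hm' := hψ1.continuous.measurable
  rw [lintegral_add_left (by fun_prop), lintegral_finsetSum _ (fun i _ => by fun_prop),
    ← enorm_sq_eq_lintegral h1, ← enorm_sq_eq_lintegral h3] at h
  simp only [← enorm_sq_eq_lintegral (h2 _)] at h
  have hsum : ∑ i, ‖z.snd.fst i‖ₑ ^ 2 ≠ ⊤ := ENNReal.sum_ne_top.2 fun i _ => by finiteness
  have h' := ENNReal.toReal_mono (by finiteness) h
  rw [ENNReal.toReal_mul, ENNReal.toReal_add (by finiteness) hsum,
    ENNReal.toReal_sum (fun i _ => by finiteness)] at h'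
  simp only [ENNReal.toReal_pow, toReal_enorm] at h'
  change ‖z.snd.snd‖ ^ 2 ≤ C.toReal * (‖z.fst‖ ^ 2 + ‖z.snd.fst‖ ^ 2)
  rwa [PiLp.norm_sq_eq_of_L2]

end TraceSpace

end TwoGroup

namespace TwoGroup

/-! ### The single-group problem: a priori bound, uniqueness, existence -/

section Solve

variable {d : ℕ} {Ω : Set (EuclideanSpace ℝ (Fin d))} {𝕜 : Type*} [RCLike 𝕜]

/-- The form `∫_Ω D ∇u·∇v̄ + σ u v̄ dx + ∫_∂Ω α u v̄ dS` of a single group. -/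
noncomputable def energy (D σ α : ℝ) (w z : TripleSpace Ω 𝕜) : 𝕜 :=
  (D : 𝕜) * inner 𝕜 z.snd.fst w.snd.fst + (σ : 𝕜) * inner 𝕜 z.fst w.fst
    + (α : 𝕜) * inner 𝕜 z.snd.snd w.snd.snd

lemma energy_sub_left (D σ α : ℝ) (w w' z : TripleSpace Ω 𝕜) :
    energy D σ α (w - w') z = energy D σ α w z - energy D σ α w' z := by
  simp only [energy, WithLp.sub_fst, WithLp.sub_snd, inner_sub_right]
  ring

lemma energy_zero_right (D σ α : ℝ) (w : TripleSpace Ω 𝕜) : energy D σ α w 0 = 0 := by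
  simp [energy]

lemma conj_energy (D σ α : ℝ) (w z : TripleSpace Ω 𝕜) :
    starRingEnd 𝕜 (energy D σ α w z) = energy D σ α z w := by
  simp [energy]

lemma re_energy_self (D σ α : ℝ) (w : TripleSpace Ω 𝕜) :
    RCLike.re (energy D σ α w w) =
      D * ‖w.snd.fst‖ ^ 2 + σ * ‖w.fst‖ ^ 2 + α * ‖w.snd.snd‖ ^ 2 := by
  simp only [energy, inner_self_eq_norm_sq_to_K, map_add]
  norm_cast

lemma min_mul_le_re_energy_self {D σ α : ℝ} (hα : 0 ≤ α) (w : TripleSpace Ω 𝕜) :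
    min D σ * (‖w.fst‖ ^ 2 + ‖w.snd.fst‖ ^ 2) ≤ RCLike.re (energy D σ α w w) := by
  rw [re_energy_self]
  have h1 := mul_le_mul_of_nonneg_right (min_le_left D σ) (sq_nonneg ‖w.snd.fst‖)
  have h2 := mul_le_mul_of_nonneg_right (min_le_right D σ) (sq_nonneg ‖w.fst‖)
  have h3 := mul_nonneg hα (sq_nonneg ‖w.snd.snd‖)
  linarith

lemma norm_sq_eq (w : TripleSpace Ω 𝕜) :
    ‖w‖ ^ 2 = ‖w.fst‖ ^ 2 + ‖w.snd.fst‖ ^ 2 + ‖w.snd.snd‖ ^ 2 := by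
  rw [WithLp.prod_norm_sq_eq_of_L2, WithLp.prod_norm_sq_eq_of_L2, add_assoc]

lemma H1.norm_triple (u : H1 Ω 𝕜) (g : BoundaryL2 Ω 𝕜) :
    ‖(triple u g).fst‖ ^ 2 + ‖(triple u g).snd.fst‖ ^ 2 = u.norm ^ 2 := by
  rw [H1.norm, Real.sq_sqrt (by positivity), PiLp.norm_sq_eq_of_L2]
  rfl

lemma H1.norm_val_le (u : H1 Ω 𝕜) : ‖u.val‖ ≤ u.norm := by
  rw [H1.norm]
  exact Real.le_sqrt_of_sq_le (le_add_of_nonneg_right (by positivity))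

/-- `u` is the weak solution of the boundary value problem of a single group with source `f`. -/
def IsSolution (D σ α : ℝ) (f : L2 Ω 𝕜) (u : H1 Ω 𝕜) : Prop :=
  ∃ g, triple u g ∈ traceGraph Ω 𝕜 ∧
    ∀ z ∈ traceGraph Ω 𝕜, energy D σ α (triple u g) z = inner 𝕜 z.fst f

/-- Testing with the solution gives `min D σ * ‖u‖₁² ≤ Re ⟨u, f⟩ ≤ ‖u‖₁ * ‖f‖`, the boundary term
being nonnegative; then one factor `‖u‖₁` is cancelled. -/
lemma IsSolution.norm_le {D σ α : ℝ} (hα : 0 ≤ α) {f : L2 Ω 𝕜} {u : H1 Ω 𝕜}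
    (h : IsSolution D σ α f u) : min D σ * u.norm ≤ ‖f‖ := by
  obtain ⟨g, hg, hsol⟩ := h
  have h1 := min_mul_le_re_energy_self (D := D) (σ := σ) hα (triple u g)
  rw [hsol _ hg, H1.norm_triple] at h1
  have h2 : RCLike.re (inner 𝕜 (triple u g).fst f) ≤ u.norm * ‖f‖ :=
    (re_inner_le_norm _ _).trans (mul_le_mul_of_nonneg_right u.norm_val_le (norm_nonneg _))
  have h0 : 0 ≤ u.norm := Real.sqrt_nonneg _
  rcases h0.eq_or_lt with h0 | h0
  · rw [← h0, mul_zero]; positivity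
  · refine le_of_mul_le_mul_left ?_ h0
    linarith [h1.trans h2]

/-- The difference of the two triples is an admissible test element with zero energy, so its
function and gradient vanish. An element of `H1` records nothing else, and the traces need not be
compared. -/
lemma IsSolution.unique {D σ α : ℝ} (hD : 0 < D) (hσ : 0 < σ) (hα : 0 ≤ α) {f : L2 Ω 𝕜}
    {u v : H1 Ω 𝕜} (hu : IsSolution D σ α f u) (hv : IsSolution D σ α f v) : u = v := by
  obtain ⟨g, hg, hu⟩ := hu
  obtain ⟨h, hh, hv⟩ := hv
  have hmem := sub_mem hg hh
  have h1 := min_mul_le_re_energy_self (D := D) (σ := σ) hα (triple u g - triple v h)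
  rw [energy_sub_left, hu _ hmem, hv _ hmem, sub_self, map_zero] at h1
  have h2 := nonpos_of_mul_nonpos_right h1 (lt_min hD hσ)
  have h3 : ‖(triple u g - triple v h).fst‖ = 0 := by
    have := sq_nonneg ‖(triple u g - triple v h).snd.fst‖
    exact pow_eq_zero_iff two_ne_zero |>.1 (le_antisymm (by linarith) (sq_nonneg _))
  have h4 : ‖(triple u g - triple v h).snd.fst‖ = 0 := by
    have := sq_nonneg ‖(triple u g - triple v h).fst‖
    exact pow_eq_zero_iff two_ne_zero |>.1 (le_antisymm (by linarith) (sq_nonneg _))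
  rw [norm_eq_zero] at h3 h4
  refine H1.ext (sub_eq_zero.1 h3) (funext fun i => sub_eq_zero.1 ?_)
  exact congrArg (fun p : PiLp 2 (fun _ : Fin d => L2 Ω 𝕜) => p i) h4

/-- The Lax–Milgram theorem for a weighted sum of squares on a complete subspace. -/
lemma exists_forall_sum_inner_eq {X H₁ H₂ H₃ : Type*}
    [NormedAddCommGroup X] [InnerProductSpace 𝕜 X]
    [NormedAddCommGroup H₁] [InnerProductSpace 𝕜 H₁] [CompleteSpace H₁]
    [NormedAddCommGroup H₂] [InnerProductSpace 𝕜 H₂] [CompleteSpace H₂]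
    [NormedAddCommGroup H₃] [InnerProductSpace 𝕜 H₃] [CompleteSpace H₃]
    (K : Submodule 𝕜 X) [CompleteSpace K]
    (G : X →L[𝕜] H₁) (F : X →L[𝕜] H₂) (B : X →L[𝕜] H₃) (D σ α : 𝕜) {m : ℝ} (hm : 0 < m)
    (hcoer : ∀ w ∈ K, m * ‖w‖ ^ 2 ≤ RCLike.re
      (D * inner 𝕜 (G w) (G w) + σ * inner 𝕜 (F w) (F w) + α * inner 𝕜 (B w) (B w)))
    (f : H₂) :
    ∃ w ∈ K, ∀ z ∈ K,
      D * inner 𝕜 (G z) (G w) + σ * inner 𝕜 (F z) (F w) + α * inner 𝕜 (B z) (B w) =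
        inner 𝕜 (F z) f := by
  let G' := G.comp K.subtypeL
  let F' := F.comp K.subtypeL
  let B' := B.comp K.subtypeL
  -- `A` represents the form on `K`. Coercivity makes it invertible, and the solution is the
  -- preimage of the vector representing the functional given by `f`.
  let A : K →L[𝕜] K :=
    D • (G'.adjoint.comp G') + σ • (F'.adjoint.comp F') + α • (B'.adjoint.comp B')
  have hA (w z : K) : inner 𝕜 z (A w) =
      D * inner 𝕜 (G z) (G w) + σ * inner 𝕜 (F z) (F w) + α * inner 𝕜 (B z) (B w) := by
    simp only [A, add_apply, smul_apply, ContinuousLinearMap.comp_apply, inner_add_right,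
      inner_smul_right, ContinuousLinearMap.adjoint_inner_right]
    rfl
  have hunit : IsUnit A := by
    refine ContinuousLinearMap.isUnit_of_forall_le_norm_inner_map A
      (Real.toNNReal_pos.2 hm) fun w => ?_
    rw [norm_inner_symm, hA, Real.coe_toNNReal _ hm.le, mul_comm]
    exact (hcoer w w.2).trans (RCLike.re_le_norm _)
  obtain ⟨w, hw⟩ := (ContinuousLinearMap.isUnit_iff_bijective.1 hunit).2 (F'.adjoint f)
  refine ⟨w, w.2, fun z hz => ?_⟩
  rw [← hA w ⟨z, hz⟩, hw, ContinuousLinearMap.adjoint_inner_right]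
  rfl

/-- The function component of a triple. -/
noncomputable def valL : TripleSpace Ω 𝕜 →L[𝕜] L2 Ω 𝕜 := WithLp.fstL 2 𝕜 _ _

/-- The gradient component of a triple. -/
noncomputable def gradL : TripleSpace Ω 𝕜 →L[𝕜] PiLp 2 (fun _ : Fin d => L2 Ω 𝕜) :=
  (WithLp.fstL 2 𝕜 _ _).comp (WithLp.sndL 2 𝕜 _ _)

/-- The boundary component of a triple. -/
noncomputable def boundaryL : TripleSpace Ω 𝕜 →L[𝕜] BoundaryL2 Ω 𝕜 :=
  (WithLp.sndL 2 𝕜 _ _).comp (WithLp.sndL 2 𝕜 _ _)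

/-- When `α = 0` the energy sees only the function and its gradient; the trace inequality makes it
coercive for the full norm of the triple, as Lax–Milgram requires. -/
lemma exists_isSolution (hd : d ≠ 0) (hΩ : IsBoundedLipschitzDomain Ω) {D σ α : ℝ}
    (hD : 0 < D) (hσ : 0 < σ) (hα : 0 ≤ α) (f : L2 Ω 𝕜) : ∃ u, IsSolution D σ α f u := by
  obtain ⟨C, hC, hle⟩ := exists_norm_boundary_sq_le hd hΩ 𝕜
  -- On the trace graph the squared norm is at most `1 + C` times the squared H¹ part.
  have hm : 0 < min D σ / (1 + C) := div_pos (lt_min hD hσ) (by linarith)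
  have hcoer (w : TripleSpace Ω 𝕜) (hw : w ∈ traceGraph Ω 𝕜) :
      min D σ / (1 + C) * ‖w‖ ^ 2 ≤ RCLike.re (energy D σ α w w) := by
    refine le_trans ?_ (min_mul_le_re_energy_self hα w)
    have h1 := hle w hw
    rw [div_mul_eq_mul_div, div_le_iff₀ (by linarith), norm_sq_eq, mul_assoc]
    exact mul_le_mul_of_nonneg_left (by linarith) (lt_min hD hσ).le
  obtain ⟨w, hw, hsol⟩ := exists_forall_sum_inner_eq (traceGraph Ω 𝕜) gradL valL boundaryL
    (D : 𝕜) (σ : 𝕜) (α : 𝕜) hm hcoer f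
  obtain ⟨u, g, -, rfl⟩ := exists_eq_triple hw
  exact ⟨u, g, hw, hsol⟩

/-! ### Decoupling of the two-group system -/

lemma IsSolution.of_forall {D σ α : ℝ} {f : L2 Ω 𝕜} {u : H1 Ω 𝕜} {g : BoundaryL2 Ω 𝕜}
    (hg : IsTrace u g) (h : ∀ v h, IsTrace v h →
      energy D σ α (triple u g) (triple v h) = inner 𝕜 v.val f) : IsSolution D σ α f u := by
  refine ⟨g, triple_mem_traceGraph_iff.2 hg, fun z hz => ?_⟩
  obtain ⟨v, k, hk, rfl⟩ := exists_eq_triple hz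
  exact h v k hk

-- Serves as the test function that switches off one of the two groups.
variable (Ω 𝕜) in
lemma exists_triple_eq_zero :
    ∃ (u : H1 Ω 𝕜) (g : BoundaryL2 Ω 𝕜), IsTrace u g ∧ triple u g = 0 := by
  obtain ⟨u, g, hg, h⟩ := exists_eq_triple (traceGraph Ω 𝕜).zero_mem
  exact ⟨u, g, hg, h.symm⟩

lemma energy_triple (D σ α : ℝ) (u v : H1 Ω 𝕜) (g h : BoundaryL2 Ω 𝕜) :
    energy D σ α (triple u g) (triple v h) =
      (∫ x in Ω, ((D : 𝕜) * ∑ i, u.grad i x * starRingEnd 𝕜 (v.grad i x)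
        + (σ : 𝕜) * u.val x * starRingEnd 𝕜 (v.val x)))
      + ∫ x, (α : 𝕜) * g x * starRingEnd 𝕜 (h x) ∂(surfaceMeasure Ω) := by
  have hi (p q : L2 Ω 𝕜) : Integrable (fun x => p x * starRingEnd 𝕜 (q x)) (volume.restrict Ω) :=
    L2.integrable_inner (𝕜 := 𝕜) q p
  simp only [mul_assoc]
  rw [integral_add ((integrable_finsetSum _ fun i _ => hi _ _).const_mul _) ((hi _ _).const_mul _),
    integral_const_mul, integral_const_mul, integral_const_mul,
    integral_finsetSum _ fun i _ => hi _ _]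
  rfl

/-- Isolates the scattering term, the only one that mixes the groups: it pairs `φ₁` with `v₂` and
never `φ₂` with `v₁`, whence the triangular structure. -/
lemma formA_eq (c : Coefficients) (φ₁ φ₂ v₁ v₂ : H1 Ω 𝕜) (g₁ g₂ h₁ h₂ : BoundaryL2 Ω 𝕜) :
    formA c φ₁ φ₂ g₁ g₂ v₁ v₂ h₁ h₂ =
      energy c.D₁ (c.Sa₁ + c.S₁₂) c.α₁ (triple φ₁ g₁) (triple v₁ h₁) +
      energy c.D₂ c.Sa₂ c.α₂ (triple φ₂ g₂) (triple v₂ h₂) -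
      (c.S₁₂ : 𝕜) * inner 𝕜 v₂.val φ₁.val := by
  have hi (p q : L2 Ω 𝕜) : Integrable (fun x => p x * starRingEnd 𝕜 (q x)) (volume.restrict Ω) :=
    L2.integrable_inner (𝕜 := 𝕜) q p
  have hb (p q : BoundaryL2 Ω 𝕜) :
      Integrable (fun x => p x * starRingEnd 𝕜 (q x)) (surfaceMeasure Ω) :=
    L2.integrable_inner (𝕜 := 𝕜) q p
  have hinner : inner 𝕜 v₂.val φ₁.val = ∫ x in Ω, φ₁.val x * starRingEnd 𝕜 (v₂.val x) := rfl
  rw [energy_triple, energy_triple, formA, hinner, ← integral_const_mul]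
  simp only [mul_assoc]
  have hi₂ : Integrable (fun x => (c.D₂ : 𝕜) * ∑ i, φ₂.grad i x * starRingEnd 𝕜 (v₂.grad i x)
      + (c.Sa₂ : 𝕜) * (φ₂.val x * starRingEnd 𝕜 (v₂.val x))) (volume.restrict Ω) :=
    ((integrable_finsetSum _ fun i _ => hi _ _).const_mul _).add ((hi _ _).const_mul _)
  rw [integral_sub hi₂ ((hi _ _).const_mul _),
    integral_add ((hb _ _).const_mul _) ((hb _ _).const_mul _)]
  ring

lemma formB_eq (c : Coefficients) (f₁ f₂ v₁ v₂ : L2 Ω 𝕜) :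
    formB c f₁ f₂ v₁ v₂ = inner 𝕜 v₁ ((c.nuSf₁ : 𝕜) • f₁ + (c.nuSf₂ : 𝕜) • f₂) := by
  rw [formB, L2.inner_def]
  refine integral_congr_ae ?_
  filter_upwards [Lp.coeFn_add ((c.nuSf₁ : 𝕜) • f₁) ((c.nuSf₂ : 𝕜) • f₂),
    Lp.coeFn_smul (c.nuSf₁ : 𝕜) f₁, Lp.coeFn_smul (c.nuSf₂ : 𝕜) f₂] with x h1 h2 h3
  rw [h1, Pi.add_apply, h2, h3, RCLike.inner_apply]
  rfl

/-- The source problem is a triangular system of single-group problems. -/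
lemma isSourceSolution_iff (c : Coefficients) (f₁ f₂ : L2 Ω 𝕜) (φ₁ φ₂ : H1 Ω 𝕜) :
    IsSourceSolution c f₁ f₂ φ₁ φ₂ ↔
      IsSolution c.D₁ (c.Sa₁ + c.S₁₂) c.α₁ ((c.nuSf₁ : 𝕜) • f₁ + (c.nuSf₂ : 𝕜) • f₂) φ₁ ∧
      IsSolution c.D₂ c.Sa₂ c.α₂ ((c.S₁₂ : 𝕜) • φ₁.val) φ₂ := by
  constructor
  · rintro ⟨g₁, g₂, hg₁, hg₂, h⟩
    obtain ⟨o, k, hk, ho⟩ := exists_triple_eq_zero Ω 𝕜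
    have ho' : o.val = 0 := congrArg WithLp.fst ho
    refine ⟨.of_forall hg₁ fun v l hl => ?_, .of_forall hg₂ fun v l hl => ?_⟩
    -- Testing with `(v, 0)` removes the second energy and the scattering term; testing with `(0,
    -- v)` below leaves the second energy and scattering, with no fission source.
    · have := h v o l k hl hk
      rwa [formA_eq, formB_eq, ho, energy_zero_right, ho', inner_zero_left, mul_zero, add_zero,
        sub_zero] at this
    · have := h o v k l hk hl
      rw [formA_eq, formB_eq, ho, energy_zero_right, ho', inner_zero_left, zero_add,
        sub_eq_zero] at this
      rw [this, inner_smul_right]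
  · rintro ⟨⟨g₁, hg₁, h₁⟩, ⟨g₂, hg₂, h₂⟩⟩
    refine ⟨g₁, g₂, triple_mem_traceGraph_iff.1 hg₁, triple_mem_traceGraph_iff.1 hg₂,
      fun v₁ v₂ l₁ l₂ hl₁ hl₂ => ?_⟩
    rw [formA_eq, formB_eq, h₁ _ (triple_mem_traceGraph_iff.2 hl₁),
      h₂ _ (triple_mem_traceGraph_iff.2 hl₂), inner_smul_right]
    exact add_sub_cancel_right _ _

/-- The adjoint problem is a triangular system of single-group problems. -/
lemma isAdjointSolution_iff (c : Coefficients) (f₁ f₂ : L2 Ω 𝕜) (φ₁ φ₂ : H1 Ω 𝕜) :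
    IsAdjointSolution c f₁ f₂ φ₁ φ₂ ↔
      IsSolution c.D₂ c.Sa₂ c.α₂ ((c.nuSf₂ : 𝕜) • f₁) φ₂ ∧
      IsSolution c.D₁ (c.Sa₁ + c.S₁₂) c.α₁ ((c.nuSf₁ : 𝕜) • f₁ + (c.S₁₂ : 𝕜) • φ₂.val) φ₁ := by
  have hconj {a b : 𝕜} : starRingEnd 𝕜 a = starRingEnd 𝕜 b ↔ a = b :=
    (starRingEnd 𝕜).injective.eq_iff
  constructor
  · rintro ⟨g₁, g₂, hg₁, hg₂, h⟩
    obtain ⟨o, k, hk, ho⟩ := exists_triple_eq_zero Ω 𝕜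
    have ho' : o.val = 0 := congrArg WithLp.fst ho
    have hz (D σ α : ℝ) (w : TripleSpace Ω 𝕜) : energy D σ α 0 w = 0 := by
      rw [← conj_energy, energy_zero_right, map_zero]
    refine ⟨.of_forall hg₂ fun v l hl => ?_, .of_forall hg₁ fun v l hl => ?_⟩
    · have := h o v k l hk hl
      rw [formA_eq, formB_eq, ho, hz, ho', inner_zero_right, mul_zero, zero_add, sub_zero,
        smul_zero, zero_add] at this
      -- The unknown sits in the conjugate-linear slot; as the coefficients are real, conjugation
      -- moves it to the linear one.
      rw [← hconj, conj_energy, this, inner_conj_symm, inner_smul_left, inner_smul_right,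
        RCLike.conj_ofReal]
    -- With test pair `(v, 0)` the scattering term survives and pairs `v` with `φ₂`, so here the
    -- second group is a source for the first.
    · have := h v o l k hl hk
      rw [formA_eq, formB_eq, ho, hz, ho', smul_zero, add_zero, add_zero, sub_eq_iff_eq_add] at this
      rw [← hconj, conj_energy, this, inner_conj_symm, inner_add_left, inner_smul_left,
        inner_smul_left, inner_smul_right, RCLike.conj_ofReal, RCLike.conj_ofReal]
  · rintro ⟨⟨g₂, hg₂, h₂⟩, ⟨g₁, hg₁, h₁⟩⟩
    refine ⟨g₁, g₂, triple_mem_traceGraph_iff.1 hg₁, triple_mem_traceGraph_iff.1 hg₂,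
      fun v₁ v₂ l₁ l₂ hl₁ hl₂ => ?_⟩
    rw [formA_eq, formB_eq, ← conj_energy, ← conj_energy c.D₂,
      h₁ _ (triple_mem_traceGraph_iff.2 hl₁), h₂ _ (triple_mem_traceGraph_iff.2 hl₂),
      inner_conj_symm, inner_conj_symm, inner_add_left, inner_smul_left, inner_smul_left,
      inner_smul_left, inner_add_right, inner_smul_right, inner_smul_right, RCLike.conj_ofReal,
      RCLike.conj_ofReal, RCLike.conj_ofReal]
    change _ + (c.S₁₂ : 𝕜) * inner 𝕜 φ₂.val v₁.val + (c.nuSf₂ : 𝕜) * inner 𝕜 f₁ v₂.val - _ =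
      (c.nuSf₁ : 𝕜) * inner 𝕜 f₁ v₁.val + _
    change (c.nuSf₁ : 𝕜) * inner 𝕜 f₁ v₁.val + _ + _ - _ = _
    ring

end Solve

end TwoGroup

/-! ### Solving the triangular systems and chaining the bounds -/

theorem mainTheorem6 {d : ℕ} (hd : d = 2 ∨ d = 3) {𝕜 : Type*} [RCLike 𝕜]
    (Ω : Set (EuclideanSpace ℝ (Fin d))) (hΩ : TwoGroup.IsBoundedLipschitzDomain Ω)
    (c : TwoGroup.Coefficients)
    (hD₁ : 0 < c.D₁) (hD₂ : 0 < c.D₂) (hSa₁ : 0 < c.Sa₁) (hSa₂ : 0 < c.Sa₂) (hS₁₂ : 0 < c.S₁₂)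
    (hnuSf₁ : 0 ≤ c.nuSf₁) (hnuSf₂ : 0 ≤ c.nuSf₂) (hα₁ : 0 ≤ c.α₁) (hα₂ : 0 ≤ c.α₂)
    (f₁ f₂ : TwoGroup.L2 Ω 𝕜) :
    -- the source problem
    ((∃! φ : TwoGroup.H1 Ω 𝕜 × TwoGroup.H1 Ω 𝕜, TwoGroup.IsSourceSolution c f₁ f₂ φ.1 φ.2) ∧
      ∀ φ₁ φ₂ : TwoGroup.H1 Ω 𝕜, TwoGroup.IsSourceSolution c f₁ f₂ φ₁ φ₂ →
        min c.D₁ (c.Sa₁ + c.S₁₂) * φ₁.norm ≤ c.nuSf₁ * ‖f₁‖ + c.nuSf₂ * ‖f₂‖ ∧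
        min c.D₂ c.Sa₂ * φ₂.norm ≤ c.S₁₂ * ‖φ₁.val‖ ∧
        c.S₁₂ * ‖φ₁.val‖ ≤
          c.S₁₂ / min c.D₁ (c.Sa₁ + c.S₁₂) * (c.nuSf₁ * ‖f₁‖ + c.nuSf₂ * ‖f₂‖) ∧
        min c.D₁ (c.Sa₁ + c.S₁₂) * φ₁.norm + min c.D₂ c.Sa₂ * φ₂.norm ≤
          (1 + c.S₁₂ / min c.D₁ (c.Sa₁ + c.S₁₂)) * (c.nuSf₁ * ‖f₁‖ + c.nuSf₂ * ‖f₂‖)) ∧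
    -- the adjoint problem
    ((∃! φ : TwoGroup.H1 Ω 𝕜 × TwoGroup.H1 Ω 𝕜, TwoGroup.IsAdjointSolution c f₁ f₂ φ.1 φ.2) ∧
      ∀ φ₁ φ₂ : TwoGroup.H1 Ω 𝕜, TwoGroup.IsAdjointSolution c f₁ f₂ φ₁ φ₂ →
        min c.D₂ c.Sa₂ * φ₂.norm ≤ c.nuSf₂ * ‖f₁‖ ∧
        min c.D₁ (c.Sa₁ + c.S₁₂) * φ₁.norm ≤ c.nuSf₁ * ‖f₁‖ + c.S₁₂ * ‖φ₂.val‖ ∧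
        c.nuSf₁ * ‖f₁‖ + c.S₁₂ * ‖φ₂.val‖ ≤
          (c.nuSf₁ + c.S₁₂ * c.nuSf₂ / min c.D₂ c.Sa₂) * ‖f₁‖ ∧
        min c.D₁ (c.Sa₁ + c.S₁₂) * φ₁.norm + min c.D₂ c.Sa₂ * φ₂.norm ≤
          (c.nuSf₁ + (1 + c.S₁₂ / min c.D₂ c.Sa₂) * c.nuSf₂) * ‖f₁‖) := by
  have hd0 : d ≠ 0 := by omega
  have hS₁ : 0 < c.Sa₁ + c.S₁₂ := add_pos hSa₁ hS₁₂
  have hm₁ : 0 < min c.D₁ (c.Sa₁ + c.S₁₂) := lt_min hD₁ hS₁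
  have hm₂ : 0 < min c.D₂ c.Sa₂ := lt_min hD₂ hSa₂
  have hnorm {a : ℝ} (ha : 0 ≤ a) (f : TwoGroup.L2 Ω 𝕜) : ‖(a : 𝕜) • f‖ = a * ‖f‖ := by
    rw [norm_smul, RCLike.norm_ofReal, abs_of_nonneg ha]
  have hval (u : TwoGroup.H1 Ω 𝕜) {m F : ℝ} (hm : 0 < m) (h : m * u.norm ≤ F) : ‖u.val‖ ≤ F / m :=
    u.norm_val_le.trans ((le_div_iff₀' hm).2 h)
  simp only [TwoGroup.isSourceSolution_iff, TwoGroup.isAdjointSolution_iff]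
  refine ⟨⟨?_, fun φ₁ φ₂ ⟨h₁, h₂⟩ => ?_⟩, ?_, fun φ₁ φ₂ ⟨h₂, h₁⟩ => ?_⟩
  · obtain ⟨φ₁, h₁⟩ := TwoGroup.exists_isSolution hd0 hΩ hD₁ hS₁ hα₁
      ((c.nuSf₁ : 𝕜) • f₁ + (c.nuSf₂ : 𝕜) • f₂)
    obtain ⟨φ₂, h₂⟩ := TwoGroup.exists_isSolution hd0 hΩ hD₂ hSa₂ hα₂ ((c.S₁₂ : 𝕜) • φ₁.val)
    refine ⟨(φ₁, φ₂), ⟨h₁, h₂⟩, fun ⟨ψ₁, ψ₂⟩ ⟨k₁, k₂⟩ => ?_⟩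
    -- The first components are identified first, since the equation of the second group has `φ₁` in
    -- its source.
    obtain rfl := h₁.unique hD₁ hS₁ hα₁ k₁
    obtain rfl := h₂.unique hD₂ hSa₂ hα₂ k₂
    rfl
  · have e₁ : min c.D₁ (c.Sa₁ + c.S₁₂) * φ₁.norm ≤ c.nuSf₁ * ‖f₁‖ + c.nuSf₂ * ‖f₂‖ :=
      (h₁.norm_le hα₁).trans ((norm_add_le _ _).trans_eq (by rw [hnorm hnuSf₁, hnorm hnuSf₂]))
    have e₂ := h₂.norm_le hα₂
    rw [hnorm hS₁₂.le] at e₂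
    have e₃ := mul_le_mul_of_nonneg_left (hval φ₁ hm₁ e₁) hS₁₂.le
    rw [mul_div_left_comm, mul_comm (c.nuSf₁ * ‖f₁‖ + c.nuSf₂ * ‖f₂‖)] at e₃
    refine ⟨e₁, e₂, e₃, ?_⟩
    rw [add_mul, one_mul]
    exact add_le_add e₁ (e₂.trans e₃)
  · obtain ⟨φ₂, h₂⟩ := TwoGroup.exists_isSolution hd0 hΩ hD₂ hSa₂ hα₂ ((c.nuSf₂ : 𝕜) • f₁)
    obtain ⟨φ₁, h₁⟩ := TwoGroup.exists_isSolution hd0 hΩ hD₁ hS₁ hα₁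
      ((c.nuSf₁ : 𝕜) • f₁ + (c.S₁₂ : 𝕜) • φ₂.val)
    refine ⟨(φ₁, φ₂), ⟨h₂, h₁⟩, fun ⟨ψ₁, ψ₂⟩ ⟨k₂, k₁⟩ => ?_⟩
    -- In the adjoint problem the order is reversed: `φ₂` enters the source of the first group.
    obtain rfl := h₂.unique hD₂ hSa₂ hα₂ k₂
    obtain rfl := h₁.unique hD₁ hS₁ hα₁ k₁
    rfl
  · have e₂ := h₂.norm_le hα₂
    rw [hnorm hnuSf₂] at e₂
    have e₁ : min c.D₁ (c.Sa₁ + c.S₁₂) * φ₁.norm ≤ c.nuSf₁ * ‖f₁‖ + c.S₁₂ * ‖φ₂.val‖ :=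
      (h₁.norm_le hα₁).trans ((norm_add_le _ _).trans_eq (by rw [hnorm hnuSf₁, hnorm hS₁₂.le]))
    have e₃ : c.nuSf₁ * ‖f₁‖ + c.S₁₂ * ‖φ₂.val‖ ≤
        (c.nuSf₁ + c.S₁₂ * c.nuSf₂ / min c.D₂ c.Sa₂) * ‖f₁‖ := by
      have := mul_le_mul_of_nonneg_left (hval φ₂ hm₂ e₂) hS₁₂.le
      calc _ ≤ c.nuSf₁ * ‖f₁‖ + c.S₁₂ * (c.nuSf₂ * ‖f₁‖ / min c.D₂ c.Sa₂) :=
            add_le_add_right this _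
        _ = _ := by ring
    refine ⟨e₂, e₁, e₃, (add_le_add (e₁.trans e₃) e₂).trans_eq ?_⟩
    ring
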